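/- Let $\nu>0$, $r\in\mathbb R$, and for $S>1$ let $\mathcal L=\mathcal L_S$ be the log-transformed Black–Scholes operator $\mathcal L u=\nu u''+(r-\nu)u'-ru$ on $[0,\log S]$ with homogeneous Dirichlet conditions, i.e. the unbounded operator on $L^2(0,\log S)$ with domain $H^2\cap H^1_0$. Let $$\Pi=\{\nu\alpha^2+(r-\nu)\alpha-r:\ \alpha\in\mathbb C,\ -\tfrac{r-\nu}{\nu}\le \operatorname{Re}\alpha\le 0\},$$ let $\lambda$ be an arbitrary point of the interior of $\Pi$ (so necessarily $r>\nu$), and put $$\alpha_\pm=\frac{-(r-\nu)\pm\sqrt{(r+\nu)^2+4\lambda\nu}}{2\nu},\qquad \alpha_+-\alpha_-=\beta+i\tau\ (\beta,\tau\in\mathbb R),\qquad \mu=\max\{\operatorname{Re}\alpha_+,\operatorname{Re}\alpha_-\},$$ $$\phi(x)=\frac{e^{\alpha_+x}-e^{\alpha_-x}}{\alpha_+-\alpha_-}\qquad(\phi(x)=xe^{\alpha_+x}\text{ if }\alpha_+=\alpha_-).$$ Let $\|\phi\|$ be the norm of $\phi$ in $L^2(0,\log S)$, let $\|(\lambda I-\mathcal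 L)^{-1}\|$ be the operator norm on $L^2(0,\log S)$, equal to $\infty$ if $\lambda$ is in the spectrum of $\mathcal L$, and write $f\sim g$ if $f/g\to1$ as $S\to\infty$ ($\nu,r,\lambda$ fixed). Then $\mu<0$ and: 1. For every $S>1$, $\|(\lambda I-\mathcal L)^{-1}\|=\infty$ if and only if $\phi(\log S)=0$; and, as $S\to\infty$ through the values with $\phi(\log S)\ne0$, $$\|(\lambda I-\mathcal L)^{-1}\|\sim\frac{\|\phi\|^2}{\nu\,|\phi(\log S)|}.$$ 2. If moreover $\lambda\notin\left(-\infty,-\frac{(r+\nu)^2}{4\nu}\right]$, then $\|(\lambda I-\mathcal L)^{-1}\|<\infty$ for all large $S$, $|\phi(\log S)|\sim S^{\mu}/|\alpha_+-\alpha_-|$, and $$\|(\lambda I-\mathcal L)^{-1}\|\sim\frac1\nu\,S^{-\mu}\,(\beta^2+\tau^2)^{1/2}\,\|\phi\|^2 .$$ 3. For every $\lambda$ in the interior of $\Pi$ and every $\kappa<-\mu$, $\|(\lambda I-\mathcal L)^{-1}\|\ge S^{\kappa}$ for all sufficiently large $S$; that is, the resolvent norm grows exponentially in $\log S$. -/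

import Mathlib

open Set Filter Topology MeasureTheory Asymptotics
open scoped ENNReal

noncomputable section

namespace BlackScholes

/-- The complex Hilbert space `L²(0, D)`. -/
abbrev L2 (D : ℝ) : Type :=
  Lp ℂ 2 ((volume : Measure ℝ).restrict (Icc 0 D))

/-- `F` is absolutely continuous on `[0, D]`, with almost everywhere derivative `f`
(stated as: `f` is integrable on `[0, D]` and `F` is a primitive of `f` there). -/
def IsPrimitiveOn (D : ℝ) (F f : ℝ → ℂ) : Prop :=
  IntegrableOn f (Icc 0 D) volume ∧
    ∀ x ∈ Icc (0 : ℝ) D, F x = F 0 + ∫ t in (0 : ℝ)..x, f t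

/-- `u` is a function in `H²(0, D) ∩ H¹₀(0, D)`: it is continuously differentiable on `[0, D]` with
derivative `u'`, which is absolutely continuous with derivative `u''` in `L²(0, D)`, and `u` vanishes
at both endpoints. -/
structure IsH2Dirichlet (D : ℝ) (u u' u'' : ℝ → ℂ) : Prop where
  prim : IsPrimitiveOn D u u'
  prim' : IsPrimitiveOn D u' u''
  memLp : MemLp u'' 2 ((volume : Measure ℝ).restrict (Icc 0 D))
  left : u 0 = 0
  right : u D = 0

lemma IsPrimitiveOn.add {D : ℝ} {F f G g : ℝ → ℂ} (hF : IsPrimitiveOn D F f)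
    (hG : IsPrimitiveOn D G g) : IsPrimitiveOn D (F + G) (f + g) := by
  refine ⟨hF.1.add hG.1, fun x hx => ?_⟩
  have key : ∀ {h : ℝ → ℂ}, IntegrableOn h (Icc 0 D) volume →
      IntervalIntegrable h volume 0 x := fun {h} hh => by
    rw [intervalIntegrable_iff_integrableOn_Icc_of_le hx.1]
    exact hh.mono_set (Icc_subset_Icc le_rfl hx.2)
  have := intervalIntegral.integral_add (key hF.1) (key hG.1)
  simp only [Pi.add_apply, this, hF.2 x hx, hG.2 x hx]
  ring

lemma IsPrimitiveOn.smul {D : ℝ} {F f : ℝ → ℂ} (c : ℂ) (hF : IsPrimitiveOn D F f) :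
    IsPrimitiveOn D (c • F) (c • f) := by
  refine ⟨hF.1.smul c, fun x hx => ?_⟩
  simp only [Pi.smul_apply, smul_eq_mul, hF.2 x hx, intervalIntegral.integral_const_mul]
  ring

lemma IsPrimitiveOn.continuousOn {D : ℝ} {F f : ℝ → ℂ} (hF : IsPrimitiveOn D F f) :
    ContinuousOn F (Icc 0 D) := by
  rcases lt_or_ge D 0 with hD | hD
  · simp [Icc_eq_empty (not_le.2 hD)]
  have h1 : ContinuousOn (fun x => F 0 + ∫ t in (0 : ℝ)..x, f t) (Icc 0 D) := by
    refine continuousOn_const.add ?_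
    have := intervalIntegral.continuousOn_primitive_interval (μ := volume) (f := f)
      (a := 0) (b := D) (by rw [uIcc_of_le hD]; exact hF.1)
    rwa [uIcc_of_le hD] at this
  exact h1.congr hF.2

/-- If an absolutely continuous function vanishes identically, so does its derivative, almost
everywhere. -/
lemma IsPrimitiveOn.ae_eq_zero {D : ℝ} {F f : ℝ → ℂ} (hF : IsPrimitiveOn D F f)
    (h0 : ∀ x ∈ Icc (0 : ℝ) D, F x = 0) :
    f =ᵐ[(volume : Measure ℝ).restrict (Icc 0 D)] 0 := by
  rcases lt_or_ge D 0 with hD | hD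
  · rw [Icc_eq_empty (not_le.2 hD), Measure.restrict_empty, EventuallyEq, ae_zero]
    exact eventually_bot
  have hint : IntervalIntegrable f volume 0 D := by
    rw [intervalIntegrable_iff_integrableOn_Icc_of_le hD]
    exact hF.1
  have hae := hint.ae_hasDerivAt_integral
  rw [restrict_Ioo_eq_restrict_Icc.symm, EventuallyEq, ae_restrict_iff' measurableSet_Ioo]
  filter_upwards [hae] with x hx hxm
  have hxI : x ∈ uIcc (0 : ℝ) D := by
    rw [uIcc_of_le hD]; exact Ioo_subset_Icc_self hxm
  have hd := hx hxI 0 (by rw [uIcc_of_le hD]; exact ⟨le_rfl, hD⟩)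
  have hz : (fun y => ∫ t in (0 : ℝ)..y, f t) =ᶠ[𝓝 x] fun _ => (0 : ℂ) := by
    filter_upwards [Ioo_mem_nhds hxm.1 hxm.2] with y hy
    have h1 := hF.2 y (Ioo_subset_Icc_self hy)
    rw [h0 y (Ioo_subset_Icc_self hy), h0 0 ⟨le_rfl, hD⟩] at h1
    simpa using h1.symm
  exact hd.unique ((hasDerivAt_const x (0 : ℂ)).congr_of_eventuallyEq hz)

/-- The graph, in `L²(0, D) × L²(0, D)`, of the log-transformed Black–Scholes operator
`u ↦ ν u'' + (r - ν) u' - r u` with homogeneous Dirichlet conditions at `0` and `D`. -/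
def graph (ν r D : ℝ) : Submodule ℂ (L2 D × L2 D) where
  carrier := {p | ∃ u u' u'' : ℝ → ℂ, IsH2Dirichlet D u u' u'' ∧
    p.1 =ᵐ[(volume : Measure ℝ).restrict (Icc 0 D)] u ∧
    p.2 =ᵐ[(volume : Measure ℝ).restrict (Icc 0 D)]
      fun x => (ν : ℂ) * u'' x + ((r : ℂ) - ν) * u' x - (r : ℂ) * u x}
  zero_mem' := by
    refine ⟨0, 0, 0, ⟨⟨integrableOn_zero, by simp⟩, ⟨integrableOn_zero, by simp⟩,
      MemLp.zero, rfl, rfl⟩, Lp.coeFn_zero _ _ _, ?_⟩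
    filter_upwards [Lp.coeFn_zero ℂ 2 ((volume : Measure ℝ).restrict (Icc 0 D))] with x hx
    simpa using hx
  add_mem' := by
    rintro p q ⟨u, u', u'', hu, hp1, hp2⟩ ⟨v, v', v'', hv, hq1, hq2⟩
    refine ⟨u + v, u' + v', u'' + v'', ⟨hu.prim.add hv.prim, hu.prim'.add hv.prim',
      hu.memLp.add hv.memLp, by simp [hu.left, hv.left], by simp [hu.right, hv.right]⟩, ?_, ?_⟩
    · filter_upwards [Lp.coeFn_add p.1 q.1, hp1, hq1] with x h h1 h2
      simpa [h1, h2] using h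
    · filter_upwards [Lp.coeFn_add p.2 q.2, hp2, hq2] with x h h1 h2
      rw [Prod.snd_add, h, Pi.add_apply, h1, h2]
      simp only [Pi.add_apply]
      ring
  smul_mem' := by
    rintro c p ⟨u, u', u'', hu, hp1, hp2⟩
    refine ⟨c • u, c • u', c • u'', ⟨hu.prim.smul c, hu.prim'.smul c,
      hu.memLp.const_smul c, by simp [hu.left], by simp [hu.right]⟩, ?_, ?_⟩
    · filter_upwards [Lp.coeFn_smul c p.1, hp1] with x h h1
      simpa [h1] using h
    · filter_upwards [Lp.coeFn_smul c p.2, hp2] with x h h1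
      rw [Prod.smul_snd, h, Pi.smul_apply, h1]
      simp only [Pi.smul_apply, smul_eq_mul]
      ring

/-- The log-transformed Black–Scholes operator `𝓛 u = ν u'' + (r - ν) u' - r u` on `[0, D]` with
homogeneous Dirichlet conditions, as an unbounded operator on `L²(0, D)` with domain
`H²(0, D) ∩ H¹₀(0, D)`. -/
def operator (ν r D : ℝ) : L2 D →ₗ.[ℂ] L2 D := (graph ν r D).toLinearPMap

/-- The defining graph is single-valued. -/
lemma graph_functional {ν r D : ℝ} (p : L2 D × L2 D) (hp : p ∈ graph ν r D)
    (h0 : p.1 = 0) : p.2 = 0 := by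
  obtain ⟨u, u', u'', hu, hp1, hp2⟩ := hp
  rcases le_or_gt D 0 with hD | hD
  · have hμ : (volume : Measure ℝ).restrict (Icc 0 D) = 0 := by
      rw [Measure.restrict_eq_zero, Real.volume_Icc]
      simpa using hD
    apply Lp.ext
    have hbot : ae ((volume : Measure ℝ).restrict (Icc 0 D)) = ⊥ := ae_eq_bot.2 hμ
    rw [EventuallyEq, hbot]
    exact eventually_bot
  have h00 : ((0 : L2 D) : ℝ → ℂ) =ᵐ[(volume : Measure ℝ).restrict (Icc 0 D)] 0 :=
    Lp.coeFn_zero _ _ _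
  rw [h0] at hp1
  have z0 : ∀ x ∈ Icc (0 : ℝ) D, u x = 0 :=
    Measure.eqOn_Icc_of_ae_eq volume hD.ne (hp1.symm.trans h00) hu.prim.continuousOn
      continuousOn_const
  have z1' := hu.prim.ae_eq_zero z0
  have z1 : ∀ x ∈ Icc (0 : ℝ) D, u' x = 0 :=
    Measure.eqOn_Icc_of_ae_eq volume hD.ne z1' hu.prim'.continuousOn continuousOn_const
  have z2 := hu.prim'.ae_eq_zero z1
  apply Lp.ext
  filter_upwards [hp2, h00, z2, z1', hp1] with x a b c d e
  have e' : u x = 0 := by rw [← e, b]; rfl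
  rw [a, b, c, d, e']
  simp

lemma operator_graph (ν r D : ℝ) : (operator ν r D).graph = graph ν r D :=
  Submodule.toLinearPMap_graph_eq _ graph_functional

section Resolvent

variable {H : Type*} [NormedAddCommGroup H] [NormedSpace ℂ H]

/-- The bounded operator `R` is the resolvent `(z I - A)⁻¹` of the unbounded operator `A`. -/
def IsResolventAt (A : H →ₗ.[ℂ] H) (z : ℂ) (R : H →L[ℂ] H) : Prop :=
  (∀ f : H, ∃ h : R f ∈ A.domain, z • R f - A ⟨R f, h⟩ = f) ∧
    ∀ u : A.domain, R (z • (u : H) - A u) = u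

/-- The resolvent norm `‖(z I - A)⁻¹‖`, with the usual convention that it is `∞` when `z` belongs to
the spectrum of `A`, that is, when no bounded inverse exists. -/
def resolventNorm (A : H →ₗ.[ℂ] H) (z : ℂ) : ℝ≥0∞ :=
  ⨅ (R : H →L[ℂ] H) (_ : IsResolventAt A z R), ‖R‖ₑ

lemma IsResolventAt.unique {A : H →ₗ.[ℂ] H} {z : ℂ} {R R' : H →L[ℂ] H}
    (h : IsResolventAt A z R) (h' : IsResolventAt A z R') : R = R' := by
  ext f
  obtain ⟨hd, he⟩ := h.1 f
  have := h'.2 ⟨R f, hd⟩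
  simp only [he] at this
  exact this.symm

lemma IsResolventAt.resolventNorm_eq {A : H →ₗ.[ℂ] H} {z : ℂ} {R : H →L[ℂ] H}
    (h : IsResolventAt A z R) : resolventNorm A z = ‖R‖ₑ := by
  apply le_antisymm
  · exact iInf₂_le R h
  · exact le_iInf₂ fun R' h' => by rw [h.unique h']

lemma resolventNorm_eq_top_iff {A : H →ₗ.[ℂ] H} {z : ℂ} :
    resolventNorm A z = ∞ ↔ ¬ ∃ R, IsResolventAt A z R := by
  simp [resolventNorm]

end Resolvent

/-- The symbol `ν α² + (r - ν) α - r`, i.e. the value `λ` with `𝓛 e^{α x} = λ e^{α x}`. -/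
def symbol (ν r : ℝ) (α : ℂ) : ℂ := (ν : ℂ) * α ^ 2 + ((r : ℂ) - ν) * α - r

/-- The closed region `Π` bounded by the critical parabola: the image of the strip
`-(r - ν)/ν ≤ Re α ≤ 0` under the symbol. -/
def regionPi (ν r : ℝ) : Set ℂ :=
  symbol ν r '' {α : ℂ | -((r - ν) / ν) ≤ α.re ∧ α.re ≤ 0}

/-- The root `α₊` of `ν α² + (r - ν) α - r = z` (principal square root). -/
def alphaPlus (ν r : ℝ) (z : ℂ) : ℂ :=
  (-((r : ℂ) - ν) + (((r : ℂ) + ν) ^ 2 + 4 * z * ν) ^ (1 / 2 : ℂ)) / (2 * ν)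

/-- The root `α₋` of `ν α² + (r - ν) α - r = z` (principal square root). -/
def alphaMinus (ν r : ℝ) (z : ℂ) : ℂ :=
  (-((r : ℂ) - ν) - (((r : ℂ) + ν) ^ 2 + 4 * z * ν) ^ (1 / 2 : ℂ)) / (2 * ν)

open Classical in
/-- The near-eigenfunction `(e^{α₊ x} - e^{α₋ x}) / (α₊ - α₋)`, read as its limit `x e^{α₊ x}`
when the two roots coincide. -/
def phi (ν r : ℝ) (z : ℂ) (x : ℝ) : ℂ :=
  if alphaPlus ν r z = alphaMinus ν r z then (x : ℂ) * Complex.exp (alphaPlus ν r z * x)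
  else (Complex.exp (alphaPlus ν r z * x) - Complex.exp (alphaMinus ν r z * x)) /
    (alphaPlus ν r z - alphaMinus ν r z)

/-- The squared norm `‖φ‖²` of `φ` in `L²(0, D)`. -/
def phiNormSq (ν r : ℝ) (z : ℂ) (D : ℝ) : ℝ := ∫ x in (0 : ℝ)..D, ‖phi ν r z x‖ ^ 2

/-- The exponent `μ = max (Re α₊) (Re α₋)`. -/
def decayRate (ν r : ℝ) (z : ℂ) : ℝ := max (alphaPlus ν r z).re (alphaMinus ν r z).re

end BlackScholes

end

namespace BlackScholes

/-! Write `p`, `q` for the two roots, `D = log S`, and `φ = fundSol p q`, the solution of the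
homogeneous equation with `φ 0 = 0` and `φ' 0 = 1`. In these terms `z I - 𝓛` acts as `u ↦ -ν (u'' -
(p + q) u' + p q u)`. Let `V f` solve `w'' - (p + q) w' + p q w = f` with zero initial data, so that
`V f` is the convolution of `φ` with `f`. The Dirichlet solution of `(z I - 𝓛) u = f` is then `-V f
/ ν` plus the multiple of `φ` that restores `u D = 0`, namely `(∫ φ(D - y) f(y) dy) / (ν φ(D))`.
Hence the resolvent is a rank one operator minus `V / ν`. The rank one part has norm exactly `‖φ‖² /
(ν |φ(D)|)`, because `φ(D - ·)` and `φ` have the same `L²` norm. If `φ(D) = 0`, then `φ` is an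
eigenfunction and no resolvent exists. For `z` interior to `Π` both roots have negative real part
(`re_neg_of_symbol_mem_interior`). This bounds `‖V‖` independently of `D`
(`exists_initialValue_operator`) and forces `φ(D)` to decay, so the rank one part tends to infinity
and dominates (`exists_isResolventAt`, `eventually_rpow_add_le`). Off the half-line the real parts
of the roots differ, and one exponential determines `|φ(D)|`. -/

/-! ### Calculus of absolutely continuous complex functions -/

lemma absolutelyContinuousOnInterval_const (c : ℂ) (a b : ℝ) :
    AbsolutelyContinuousOnInterval (fun _ : ℝ => c) a b :=
  (contDiff_const (c := c)).contDiffOn.absolutelyContinuousOnInterval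

/-- Indefinite integrals of complex functions are absolutely continuous. -/
lemma absolutelyContinuousOnInterval_integral {f : ℝ → ℂ} {a b : ℝ}
    (hf : IntervalIntegrable f volume a b) :
    AbsolutelyContinuousOnInterval (fun x => ∫ t in a..x, f t) a b := by
  -- The real-valued case is applied to real and imaginary parts, which are recombined with the
  -- constants `1` and `I`.
  have hre : IntervalIntegrable (fun t => (f t).re) volume a b := ⟨hf.1.re, hf.2.re⟩
  have him : IntervalIntegrable (fun t => (f t).im) volume a b := ⟨hf.1.im, hf.2.im⟩
  have h1 := (hre.absolutelyContinuousOnInterval_intervalIntegral left_mem_uIcc).smul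
    (absolutelyContinuousOnInterval_const 1 a b)
  have h2 := (him.absolutelyContinuousOnInterval_intervalIntegral left_mem_uIcc).smul
    (absolutelyContinuousOnInterval_const Complex.I a b)
  have h3 := h1.add h2
  have hcongr : ∀ x ∈ uIcc a b, ((fun x => ∫ t in a..x, (f t).re) • (fun _ : ℝ => (1 : ℂ)) +
      (fun x => ∫ t in a..x, (f t).im) • (fun _ : ℝ => Complex.I)) x = ∫ t in a..x, f t := by
    intro x hx
    have hx' : IntervalIntegrable f volume a x := hf.mono_set (uIcc_subset_uIcc_left hx)
    have e1 : (∫ t in a..x, f t).re = ∫ t in a..x, (f t).re :=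
      (Complex.reCLM.intervalIntegral_comp_comm hx').symm
    have e2 : (∫ t in a..x, f t).im = ∫ t in a..x, (f t).im :=
      (Complex.imCLM.intervalIntegral_comp_comm hx').symm
    simp only [Pi.add_apply, Pi.smul_apply', ← e1, ← e2]
    simp [Complex.re_add_im]
  rw [absolutelyContinuousOnInterval_iff] at h3 ⊢
  intro ε hε
  obtain ⟨δ, hδ, h⟩ := h3 ε hε
  refine ⟨δ, hδ, fun E hE hlt => ?_⟩
  have := h E hE hlt
  convert this using 2 with i hi
  rw [hcongr _ (hE.1 i hi).1, hcongr _ (hE.1 i hi).2]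

/-- Product rule for absolutely continuous functions. -/
lemma IsPrimitiveOn.mul {D : ℝ} {F f G g : ℝ → ℂ} (hD : 0 ≤ D) (hF : IsPrimitiveOn D F f)
    (hG : IsPrimitiveOn D G g) :
    IsPrimitiveOn D (fun x => F x * G x) (fun x => f x * G x + F x * g x) := by
  have hi : ∀ {h : ℝ → ℂ}, IntegrableOn h (Icc 0 D) volume → IntervalIntegrable h volume 0 D :=
    fun hh => (intervalIntegrable_iff_integrableOn_Icc_of_le hD).2 hh
  have hu : uIcc 0 D = Icc 0 D := uIcc_of_le hD
  have hint : IntegrableOn (fun x => f x * G x + F x * g x) (Icc 0 D) volume :=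
    (hF.1.mul_continuousOn hG.continuousOn isCompact_Icc).add
      (hG.1.continuousOn_mul hF.continuousOn isCompact_Icc)
  refine ⟨hint, ?_⟩
  have hFac := (absolutelyContinuousOnInterval_const (F 0) 0 D).add
    (absolutelyContinuousOnInterval_integral (hi hF.1))
  have hGac := (absolutelyContinuousOnInterval_const (G 0) 0 D).add
    (absolutelyContinuousOnInterval_integral (hi hG.1))
  -- `F G - ∫ (f G + F g)` is absolutely continuous with derivative zero almost everywhere, hence
  -- constant; its value at `0` is `F 0 * G 0`.
  have hH := (hFac.smul hGac).sub (absolutelyContinuousOnInterval_integral (hi hint))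
  obtain ⟨C, hC⟩ := hH.const_of_ae_hasDerivAt_zero (by
    filter_upwards [(hi hF.1).ae_hasDerivAt_integral, (hi hG.1).ae_hasDerivAt_integral,
      (hi hint).ae_hasDerivAt_integral] with x h1 h2 h3 hx
    have k1 := (h1 hx 0 left_mem_uIcc).const_add (F 0)
    have k2 := (h2 hx 0 left_mem_uIcc).const_add (G 0)
    have k3 := h3 hx 0 left_mem_uIcc
    have k := (k1.mul k2).sub k3
    rw [hu] at hx
    rw [← hF.2 x hx, ← hG.2 x hx, sub_self] at k
    exact k)
  intro x hx
  have c0 := hC 0 left_mem_uIcc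
  have cx := hC x (hu ▸ hx)
  simp only [Pi.sub_apply, Pi.mul_apply, Pi.add_apply, smul_eq_mul,
    intervalIntegral.integral_same, add_zero, sub_zero] at c0 cx
  rw [← hF.2 x hx, ← hG.2 x hx, ← c0, sub_eq_iff_eq_add] at cx
  exact cx

lemma IsPrimitiveOn.of_hasDerivAt {F f : ℝ → ℂ} (h : ∀ x, HasDerivAt F (f x) x)
    (hf : Continuous f) (D : ℝ) : IsPrimitiveOn D F f := by
  refine ⟨hf.continuousOn.integrableOn_compact isCompact_Icc, fun x _ => ?_⟩
  rw [intervalIntegral.integral_eq_sub_of_hasDerivAt (fun y _ => h y)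
    (hf.intervalIntegrable _ _)]
  ring

lemma IsPrimitiveOn.mono {D x : ℝ} {F f : ℝ → ℂ} (hF : IsPrimitiveOn D F f) (hx : x ≤ D) :
    IsPrimitiveOn x F f :=
  ⟨hF.1.mono_set (Icc_subset_Icc_right hx), fun y hy => hF.2 y ⟨hy.1, hy.2.trans hx⟩⟩

/-- The fundamental theorem of calculus at the right endpoint. -/
lemma IsPrimitiveOn.integral_eq {D : ℝ} {F f : ℝ → ℂ} (hD : 0 ≤ D) (hF : IsPrimitiveOn D F f) :
    ∫ t in (0 : ℝ)..D, f t = F D - F 0 := by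
  rw [hF.2 D ⟨hD, le_rfl⟩]; ring

lemma IsPrimitiveOn.conj {D : ℝ} {F f : ℝ → ℂ} (hF : IsPrimitiveOn D F f) :
    IsPrimitiveOn D (fun x => (starRingEnd ℂ) (F x)) (fun x => (starRingEnd ℂ) (f x)) := by
  refine ⟨Complex.conjCLE.toContinuousLinearMap.integrable_comp hF.1, fun x hx => ?_⟩
  simp only [hF.2 x hx, map_add]
  rw [intervalIntegral.integral_of_le hx.1,
    intervalIntegral.integral_of_le hx.1, integral_conj]

/-! ### The fundamental solution and variation of constants -/

/-- The fundamental solution `(e^{p x} - e^{q x}) / (p - q)` of `u'' - (p + q) u' + p q u = 0`. -/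
noncomputable def fundSol (p q : ℂ) (x : ℝ) : ℂ :=
  if p = q then (x : ℂ) * Complex.exp (p * x)
  else (Complex.exp (p * x) - Complex.exp (q * x)) / (p - q)

/-- The derivative of `fundSol p q`. -/
noncomputable def fundSolDeriv (p q : ℂ) (x : ℝ) : ℂ := p * fundSol p q x + Complex.exp (q * x)

lemma hasDerivAt_cexp_mul (c : ℂ) (x : ℝ) :
    HasDerivAt (fun x : ℝ => Complex.exp (c * x)) (c * Complex.exp (c * x)) x := by
  have h := ((Complex.ofRealCLM.hasDerivAt (x := x)).const_mul c).cexp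
  simpa [mul_comm] using h

lemma hasDerivAt_fundSol (p q : ℂ) (x : ℝ) :
    HasDerivAt (fundSol p q) (fundSolDeriv p q x) x := by
  by_cases h : p = q
  · subst h
    have e : fundSol p p = fun x : ℝ => (x : ℂ) * Complex.exp (p * x) := by
      ext; simp [fundSol]
    rw [fundSolDeriv, e]
    convert! (Complex.ofRealCLM.hasDerivAt (x := x)).mul (hasDerivAt_cexp_mul p x) using 1
    simp; ring
  · have e : fundSol p q = fun x : ℝ =>
        (Complex.exp (p * x) - Complex.exp (q * x)) / (p - q) := by
      ext; simp [fundSol, h]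
    rw [fundSolDeriv, e]
    convert! ((hasDerivAt_cexp_mul p x).sub (hasDerivAt_cexp_mul q x)).div_const (p - q) using 1
    have : p - q ≠ 0 := sub_ne_zero.2 h
    field_simp
    ring

lemma hasDerivAt_fundSolDeriv (p q : ℂ) (x : ℝ) :
    HasDerivAt (fundSolDeriv p q) ((p + q) * fundSolDeriv p q x - p * q * fundSol p q x) x := by
  convert! ((hasDerivAt_fundSol p q x).const_mul p).add (hasDerivAt_cexp_mul q x) using 1
  simp only [fundSolDeriv]
  ring

@[simp] lemma fundSol_zero (p q : ℂ) : fundSol p q 0 = 0 := by simp [fundSol]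

@[simp] lemma fundSolDeriv_zero (p q : ℂ) : fundSolDeriv p q 0 = 1 := by simp [fundSolDeriv]

lemma continuous_fundSol (p q : ℂ) : Continuous (fundSol p q) :=
  continuous_iff_continuousAt.2 fun x => (hasDerivAt_fundSol p q x).continuousAt

lemma continuous_fundSolDeriv (p q : ℂ) : Continuous (fundSolDeriv p q) :=
  continuous_iff_continuousAt.2 fun x => (hasDerivAt_fundSolDeriv p q x).continuousAt

/-- Variation of constants. -/
lemma eq_fundSol_add_integral {D : ℝ} {p q : ℂ} {u u' u'' : ℝ → ℂ} (hu : IsPrimitiveOn D u u')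
    (hu' : IsPrimitiveOn D u' u'') (h0 : u 0 = 0) {x : ℝ} (hx : x ∈ Icc 0 D) :
    u x = u' 0 * fundSol p q x +
      ∫ y in (0 : ℝ)..x, fundSol p q (x - y) * (u'' y - (p + q) * u' y + p * q * u y) := by
  have hφ : IsPrimitiveOn x (fun y => fundSol p q (x - y)) (fun y => -fundSolDeriv p q (x - y)) :=
    IsPrimitiveOn.of_hasDerivAt (fun y => by
      exact (hasDerivAt_fundSol p q (x - y)).comp_const_sub x y)
      (by have := continuous_fundSolDeriv p q; fun_prop) x
  have hψ : IsPrimitiveOn x (fun y => fundSolDeriv p q (x - y))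
      (fun y => -((p + q) * fundSolDeriv p q (x - y) - p * q * fundSol p q (x - y))) :=
    IsPrimitiveOn.of_hasDerivAt (fun y => by
      exact (hasDerivAt_fundSolDeriv p q (x - y)).comp_const_sub x y)
      (by have := continuous_fundSolDeriv p q; have := continuous_fundSol p q; fun_prop) x
  -- Green's identity: the integrand is the derivative in `y` of `φ(x - y) u' + φ'(x - y) u - (p +
  -- q) φ(x - y) u`. This equals `u x` at `y = x` and `φ(x) u' 0` at `y = 0`.
  have a1 := hφ.mul hx.1 (hu'.mono hx.2)
  have a2 := hψ.mul hx.1 (hu.mono hx.2)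
  have a3 := (hφ.mul hx.1 (hu.mono hx.2)).smul (-(p + q))
  have h := ((a1.add a2).add a3).integral_eq hx.1
  have e : ∀ y, fundSol p q (x - y) * (u'' y - (p + q) * u' y + p * q * u y) =
      (((fun y => -fundSolDeriv p q (x - y) * u' y + fundSol p q (x - y) * u'' y) +
        fun y => -((p + q) * fundSolDeriv p q (x - y) - p * q * fundSol p q (x - y)) * u y +
          fundSolDeriv p q (x - y) * u' y) +
      -(p + q) • fun y => -fundSolDeriv p q (x - y) * u y + fundSol p q (x - y) * u' y) y := by
    intro y
    simp only [Pi.add_apply, Pi.smul_apply, smul_eq_mul]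
    ring
  simp only [e, h]
  simp [h0]
  ring

/-! ### Norms and inner products in `L²(0, D)` -/

lemma L2.integrableOn {D : ℝ} (f : L2 D) : IntegrableOn f (Icc 0 D) volume :=
  (Lp.memLp f).integrable one_le_two

lemma memLp_of_continuousOn {D : ℝ} {g : ℝ → ℂ} (hg : ContinuousOn g (Icc 0 D)) :
    MemLp g 2 ((volume : Measure ℝ).restrict (Icc 0 D)) := by
  obtain ⟨C, hC⟩ := isCompact_Icc.exists_bound_of_continuousOn hg
  exact MemLp.of_bound (hg.aestronglyMeasurable measurableSet_Icc) C
    ((ae_restrict_iff' measurableSet_Icc).2 (Eventually.of_forall hC))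

lemma L2.norm_sq_eq {D : ℝ} (hD : 0 ≤ D) (f : L2 D) {g : ℝ → ℂ}
    (hfg : f =ᵐ[(volume : Measure ℝ).restrict (Icc 0 D)] g) :
    ‖f‖ ^ 2 = ∫ x in (0 : ℝ)..D, ‖g x‖ ^ 2 := by
  have h : (inner ℂ f f : ℂ) = ((∫ x in (0 : ℝ)..D, ‖g x‖ ^ 2 : ℝ) : ℂ) := by
    rw [MeasureTheory.L2.inner_def, intervalIntegral.integral_of_le hD,
      ← integral_Icc_eq_integral_Ioc, ← integral_complex_ofReal]
    apply integral_congr_ae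
    filter_upwards [hfg] with x hx
    rw [hx, inner_self_eq_norm_sq_to_K]
    simp
  rw [inner_self_eq_norm_sq_to_K] at h
  apply Complex.ofReal_injective
  rw [Complex.ofReal_pow]
  exact h

lemma L2.inner_eq {D : ℝ} (hD : 0 ≤ D) (f g : L2 D) {a b : ℝ → ℂ}
    (hf : f =ᵐ[(volume : Measure ℝ).restrict (Icc 0 D)] a)
    (hg : g =ᵐ[(volume : Measure ℝ).restrict (Icc 0 D)] b) :
    (inner ℂ f g : ℂ) = ∫ x in (0 : ℝ)..D, (starRingEnd ℂ) (a x) * b x := by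
  rw [MeasureTheory.L2.inner_def, intervalIntegral.integral_of_le hD,
    ← integral_Icc_eq_integral_Ioc]
  apply integral_congr_ae
  filter_upwards [hf, hg] with x hx hy
  rw [hx, hy, RCLike.inner_apply, mul_comm]

/-! ### First-order equations and the initial value problem -/

/-- The solution of `g' = α g + f` with `g 0 = 0`. -/
noncomputable def expConv (α : ℂ) (f : ℝ → ℂ) (x : ℝ) : ℂ :=
  Complex.exp (α * x) * ∫ y in (0 : ℝ)..x, Complex.exp (-α * y) * f y

lemma expConv_zero (α : ℂ) (f : ℝ → ℂ) : expConv α f 0 = 0 := by simp [expConv]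

lemma isPrimitiveOn_expConv {D : ℝ} (hD : 0 ≤ D) (α : ℂ) {f : ℝ → ℂ}
    (hf : IntegrableOn f (Icc 0 D) volume) :
    IsPrimitiveOn D (expConv α f) (fun x => α * expConv α f x + f x) := by
  have hc : ∀ c : ℂ, Continuous fun x : ℝ => Complex.exp (c * x) := fun c => by fun_prop
  have h1 : IsPrimitiveOn D (fun x : ℝ => Complex.exp (α * x))
      (fun x : ℝ => α * Complex.exp (α * x)) :=
    IsPrimitiveOn.of_hasDerivAt (hasDerivAt_cexp_mul α) (by fun_prop) D
  have h2 : IsPrimitiveOn D (fun x => ∫ y in (0 : ℝ)..x, Complex.exp (-α * y) * f y)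
      (fun y => Complex.exp (-α * y) * f y) :=
    ⟨hf.continuousOn_mul (hc (-α)).continuousOn isCompact_Icc, fun x _ => by simp⟩
  have h := h1.mul hD h2
  have e : (fun x => α * expConv α f x + f x) = fun x : ℝ =>
      (α * Complex.exp (α * x) * ∫ y in (0 : ℝ)..x, Complex.exp (-α * y) * f y) +
        Complex.exp (α * x) * (Complex.exp (-α * x) * f x) := by
    funext x
    rw [expConv, ← mul_assoc (Complex.exp _) (Complex.exp _), ← Complex.exp_add, ← mul_assoc]
    simp
  rw [e]
  exact h

/-- Lets `expConv` act on `L²` classes: its pointwise values do not depend on the representative,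
which gives linearity and allows two such operators to be composed. -/
lemma expConv_congr {D : ℝ} (α : ℂ) {f g : ℝ → ℂ}
    (h : f =ᵐ[(volume : Measure ℝ).restrict (Icc 0 D)] g) {x : ℝ} (hx : x ∈ Icc 0 D) :
    expConv α f x = expConv α g x := by
  rw [expConv, expConv]
  congr 1
  apply intervalIntegral.integral_congr_ae_restrict
  rw [uIoc_of_le hx.1]
  filter_upwards [ae_restrict_of_ae_restrict_of_subset
    (Ioc_subset_Icc_self.trans (Icc_subset_Icc_right hx.2)) h] with y hy
  rw [hy]

lemma ae_Icc_of_forall {D : ℝ} {P : ℝ → Prop} (h : ∀ x ∈ Icc (0 : ℝ) D, P x) :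
    ∀ᵐ x ∂((volume : Measure ℝ).restrict (Icc 0 D)), P x :=
  (ae_restrict_iff' measurableSet_Icc).2 (Eventually.of_forall h)

/-- Energy estimate for `g' = α g + f`, `g 0 = 0`, when `Re α < 0`. -/
lemma energy_estimate {D : ℝ} (hD : 0 ≤ D) {α : ℂ} (hα : α.re < 0) (f g : L2 D) {G : ℝ → ℂ}
    (hG : IsPrimitiveOn D G (fun x => α * G x + f x)) (h0 : G 0 = 0)
    (hgG : g =ᵐ[(volume : Measure ℝ).restrict (Icc 0 D)] G) :
    ‖g‖ ≤ (-α.re)⁻¹ * ‖f‖ := by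
  -- Integrating `(|G|²)'` gives `|G D|² = 2 Re α ‖g‖² + 2 Re ⟨g, f⟩`. Discarding `|G D|² ≥ 0` and
  -- applying Cauchy–Schwarz gives the bound.
  have e1 := (hG.conj.mul hD hG).integral_eq hD
  simp only [h0, map_zero, mul_zero, sub_zero] at e1
  have ff : f =ᵐ[(volume : Measure ℝ).restrict (Icc 0 D)] f := ae_eq_refl _
  have igg := L2.inner_eq hD g g hgG hgG
  have igf := L2.inner_eq hD g f hgG ff
  have ifg := L2.inner_eq hD f g ff hgG
  have hi : ∀ {a b : L2 D} {A B : ℝ → ℂ},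
      a =ᵐ[(volume : Measure ℝ).restrict (Icc 0 D)] A →
      b =ᵐ[(volume : Measure ℝ).restrict (Icc 0 D)] B →
      IntervalIntegrable (fun x => (starRingEnd ℂ) (A x) * B x) volume 0 D := by
    intro a b A B ha hb
    rw [intervalIntegrable_iff_integrableOn_Icc_of_le hD]
    refine (MeasureTheory.L2.integrable_inner a b).congr ?_
    filter_upwards [ha, hb] with x hx hy
    rw [hx, hy, RCLike.inner_apply, mul_comm]
  have key : (starRingEnd ℂ) (G D) * G D =
      (starRingEnd ℂ α + α) * inner ℂ g g + (inner ℂ f g + inner ℂ g f) := by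
    rw [← e1, igg, igf, ifg, ← intervalIntegral.integral_const_mul,
      ← intervalIntegral.integral_add (hi ff hgG) (hi hgG ff),
      ← intervalIntegral.integral_add ((hi hgG hgG).const_mul _)
        ((hi ff hgG).add (hi hgG ff))]
    congr 1
    ext x
    simp only [map_add, map_mul]
    ring
  have kre := congrArg Complex.re key
  have h2 : (inner ℂ f g : ℂ).re = (inner ℂ g f : ℂ).re := by
    rw [← inner_conj_symm, Complex.conj_re]
  have h3 : (inner ℂ g g : ℂ) = ((‖g‖ ^ 2 : ℝ) : ℂ) := by
    rw [inner_self_eq_norm_sq_to_K]; simp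
  have h4 : (inner ℂ g f : ℂ).re ≤ ‖g‖ * ‖f‖ :=
    (Complex.re_le_norm _).trans (norm_inner_le_norm g f)
  have h5 : (starRingEnd ℂ) (G D) * G D = ((Complex.normSq (G D) : ℝ) : ℂ) := by
    rw [mul_comm, Complex.mul_conj]
  have h6 : starRingEnd ℂ α + α = ((2 * α.re : ℝ) : ℂ) := by
    rw [add_comm, Complex.add_conj]
  rw [h5, h3, h6, ← Complex.ofReal_mul, Complex.add_re, Complex.add_re, Complex.ofReal_re,
    Complex.ofReal_re, h2] at kre
  have h7 := Complex.normSq_nonneg (G D)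
  have h8 : (-α.re) * ‖g‖ ^ 2 ≤ ‖g‖ * ‖f‖ := by nlinarith
  rw [inv_mul_eq_div, le_div_iff₀ (by linarith)]
  rcases (norm_nonneg g).eq_or_lt with h | h
  · rw [← h]; simp
  · exact le_of_mul_le_mul_left (by linarith) h

/-- Solving `g' = α g + f`, `g 0 = 0` is a bounded operation on `L²`, uniformly in the interval. -/
lemma exists_expConv_operator {D : ℝ} (hD : 0 ≤ D) {α : ℂ} (hα : α.re < 0) :
    ∃ T : L2 D →L[ℂ] L2 D, ‖T‖ ≤ (-α.re)⁻¹ ∧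
      ∀ f : L2 D, T f =ᵐ[(volume : Measure ℝ).restrict (Icc 0 D)] expConv α f := by
  have hm : ∀ f : L2 D, MemLp (expConv α f) 2 ((volume : Measure ℝ).restrict (Icc 0 D)) :=
    fun f => memLp_of_continuousOn (isPrimitiveOn_expConv hD α f.integrableOn).continuousOn
  have hint : ∀ (f : L2 D) {x : ℝ}, x ∈ Icc 0 D →
      IntervalIntegrable (fun y => Complex.exp (-α * y) * f y) volume 0 x := by
    intro f x hx
    rw [intervalIntegrable_iff_integrableOn_Icc_of_le hx.1]
    exact (f.integrableOn.mono_set (Icc_subset_Icc_right hx.2)).continuousOn_mul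
      (by fun_prop) isCompact_Icc
  let L : L2 D →ₗ[ℂ] L2 D :=
    { toFun := fun f => (hm f).toLp
      map_add' := fun f g => by
        rw [← MemLp.toLp_add]
        apply MemLp.toLp_congr
        refine ae_Icc_of_forall fun x hx => ?_
        rw [expConv_congr α (Lp.coeFn_add f g) hx, Pi.add_apply, expConv, expConv, expConv,
          ← mul_add, ← intervalIntegral.integral_add (hint f hx) (hint g hx)]
        simp only [Pi.add_apply, mul_add]
      map_smul' := fun c f => by
        rw [RingHom.id_apply, ← MemLp.toLp_const_smul]
        apply MemLp.toLp_congr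
        refine ae_Icc_of_forall fun x hx => ?_
        rw [expConv_congr α (Lp.coeFn_smul c f) hx, Pi.smul_apply, expConv, expConv, smul_eq_mul,
          mul_left_comm]
        have e : ∀ y : ℝ, Complex.exp (-α * y) * (c • (f : ℝ → ℂ)) y =
            c * (Complex.exp (-α * y) * f y) := fun y => by
          rw [Pi.smul_apply, smul_eq_mul]
          ring
        simp only [e, intervalIntegral.integral_const_mul] }
  have hL : ∀ f, L f =ᵐ[(volume : Measure ℝ).restrict (Icc 0 D)] expConv α f :=
    fun f => (hm f).coeFn_toLp
  have hb : ∀ f, ‖L f‖ ≤ (-α.re)⁻¹ * ‖f‖ := fun f =>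
    energy_estimate hD hα f (L f) (isPrimitiveOn_expConv hD α f.integrableOn)
      (expConv_zero α f) (hL f)
  exact ⟨L.mkContinuous _ hb, L.mkContinuous_norm_le (inv_nonneg.2 (by linarith)) hb, hL⟩

/-- The initial value problem `w'' - (p + q) w' + p q w = f`, `w 0 = w' 0 = 0` is solved by a
bounded operator on `L²`, uniformly in the interval, when `Re p, Re q < 0`. -/
lemma exists_initialValue_operator {D : ℝ} (hD : 0 ≤ D) {p q : ℂ} (hp : p.re < 0)
    (hq : q.re < 0) :
    ∃ V : L2 D →L[ℂ] L2 D, ‖V‖ ≤ (-p.re)⁻¹ * (-q.re)⁻¹ ∧ ∀ f : L2 D, ∃ w w' w'' : ℝ → ℂ,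
      IsPrimitiveOn D w w' ∧ IsPrimitiveOn D w' w'' ∧
      MemLp w'' 2 ((volume : Measure ℝ).restrict (Icc 0 D)) ∧ w 0 = 0 ∧ w' 0 = 0 ∧
      V f =ᵐ[(volume : Measure ℝ).restrict (Icc 0 D)] w ∧
      ∀ x, w'' x - (p + q) * w' x + p * q * w x = f x := by
  obtain ⟨T, hT, hTf⟩ := exists_expConv_operator hD hp
  obtain ⟨U, hU, hUf⟩ := exists_expConv_operator hD hq
  -- The second-order operator factors as `(d/dx - p)(d/dx - q)`, so two first-order problems are
  -- solved in turn: `g' = q g + f`, then `w' = p w + g`.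
  refine ⟨T.comp U, (T.opNorm_comp_le U).trans (mul_le_mul hT hU (norm_nonneg _)
    (inv_nonneg.2 (by linarith))), fun f => ?_⟩
  set g := expConv q f with hg
  have hgp : IsPrimitiveOn D g (fun x => q * g x + f x) := isPrimitiveOn_expConv hD q f.integrableOn
  have hgi : IntegrableOn g (Icc 0 D) volume := hgp.continuousOn.integrableOn_compact isCompact_Icc
  set w := expConv p g with hw
  have hwp : IsPrimitiveOn D w (fun x => p * w x + g x) := isPrimitiveOn_expConv hD p hgi
  have hw'p := (hwp.smul p).add hgp
  refine ⟨w, fun x => p * w x + g x, fun x => p * (p * w x + g x) + (q * g x + f x), hwp, hw'p,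
    ?_, expConv_zero _ _, by simp [hw, hg, expConv_zero], ?_, fun x => by ring⟩
  · refine MemLp.add (memLp_of_continuousOn (continuousOn_const.mul
      ((continuousOn_const.mul hwp.continuousOn).add hgp.continuousOn)))
      (MemLp.add (memLp_of_continuousOn (continuousOn_const.mul hgp.continuousOn)) (Lp.memLp f))
  · refine (hTf (U f)).trans (ae_Icc_of_forall fun x hx => ?_)
    exact expConv_congr p (hUf f) hx

/-! ### The resolvent as rank one plus bounded -/

lemma isResolventAt_of_graph {H : Type*} [NormedAddCommGroup H] [NormedSpace ℂ H]
    {A : H →ₗ.[ℂ] H} {z : ℂ} {R : H →L[ℂ] H} (h1 : ∀ f, (R f, z • R f - f) ∈ A.graph)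
    (h2 : ∀ u v, (u, v) ∈ A.graph → R (z • u - v) = u) : IsResolventAt A z R := by
  refine ⟨fun f => ?_, fun u => h2 _ _ (A.mem_graph u)⟩
  obtain ⟨y, hy1, hy2⟩ := (LinearPMap.mem_graph_iff A).1 (h1 f)
  simp only at hy1 hy2
  refine ⟨hy1 ▸ y.2, ?_⟩
  have : (⟨R f, hy1 ▸ y.2⟩ : A.domain) = y := Subtype.ext hy1.symm
  rw [this, hy2]
  abel

/-- The resolvent is a rank one operator of explicit norm, up to an error which is bounded
uniformly in the interval. -/
lemma exists_isResolventAt {ν r D : ℝ} {z p q : ℂ} (hν : 0 < ν) (hD : 0 ≤ D) (hp : p.re < 0)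
    (hq : q.re < 0) (hadd : (ν : ℂ) * (p + q) = ν - r) (hmul : (ν : ℂ) * (p * q) = -(r + z))
    (hφ : fundSol p q D ≠ 0) :
    ∃ R : L2 D →L[ℂ] L2 D, IsResolventAt (operator ν r D) z R ∧
      |‖R‖ - (∫ x in (0 : ℝ)..D, ‖fundSol p q x‖ ^ 2) / (ν * ‖fundSol p q D‖)| ≤
        ν⁻¹ * ((-p.re)⁻¹ * (-q.re)⁻¹) := by
  have hν' : (ν : ℂ) ≠ 0 := by exact_mod_cast hν.ne'
  obtain ⟨V, hV, hVf⟩ := exists_initialValue_operator hD hp hq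
  have hΦm : MemLp (fundSol p q) 2 ((volume : Measure ℝ).restrict (Icc 0 D)) :=
    memLp_of_continuousOn (continuous_fundSol p q).continuousOn
  have hΨm : MemLp (fun x => (starRingEnd ℂ) (fundSol p q (D - x))) 2
      ((volume : Measure ℝ).restrict (Icc 0 D)) :=
    memLp_of_continuousOn (Continuous.continuousOn
      (Complex.continuous_conj.comp ((continuous_fundSol p q).comp (by fun_prop))))
  set Φ : L2 D := hΦm.toLp with hΦ
  set Ψ : L2 D := hΨm.toLp with hΨ
  have hΦn : ‖Φ‖ ^ 2 = ∫ x in (0 : ℝ)..D, ‖fundSol p q x‖ ^ 2 :=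
    L2.norm_sq_eq hD Φ hΦm.coeFn_toLp
  -- The reflection `x ↦ D - x` preserves the `L²` norm.
  have hΨn : ‖Ψ‖ = ‖Φ‖ := by
    refine (sq_eq_sq₀ (norm_nonneg _) (norm_nonneg _)).1 ?_
    rw [hΦn, L2.norm_sq_eq hD Ψ hΨm.coeFn_toLp]
    simp only [RCLike.norm_conj]
    simpa using intervalIntegral.integral_comp_sub_left
      (fun x => ‖fundSol p q x‖ ^ 2) (a := 0) (b := D) D
  -- The coefficient of `Φ` is the one that cancels the value of `-V f / ν` at `D`.
  set K : L2 D →L[ℂ] L2 D := ((ν : ℂ) * fundSol p q D)⁻¹ • InnerProductSpace.rankOne ℂ Φ Ψ with hK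
  have hKn : ‖K‖ = (∫ x in (0 : ℝ)..D, ‖fundSol p q x‖ ^ 2) / (ν * ‖fundSol p q D‖) := by
    rw [hK, norm_smul, InnerProductSpace.norm_rankOne, hΨn, ← hΦn, norm_inv, norm_mul,
      Complex.norm_real, Real.norm_of_nonneg hν.le]
    ring
  set R : L2 D →L[ℂ] L2 D := K - (ν : ℂ)⁻¹ • V with hR
  have hmemD : D ∈ Icc (0 : ℝ) D := ⟨hD, le_rfl⟩
  have hRf : ∀ f, R f = (((ν : ℂ) * fundSol p q D)⁻¹ * inner ℂ Ψ f) • Φ - (ν : ℂ)⁻¹ • V f := by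
    intro f
    simp [hR, hK, smul_smul]
  have hΨf : ∀ f : L2 D, inner ℂ Ψ f = ∫ x in (0 : ℝ)..D, fundSol p q (D - x) * f x := by
    intro f
    rw [L2.inner_eq hD Ψ f hΨm.coeFn_toLp (ae_eq_refl _)]
    simp
  refine ⟨R, ?_, ?_⟩
  · apply isResolventAt_of_graph
    · intro f
      obtain ⟨w, w', w'', hw, hw', hm, h0, h0', hVw, heq⟩ := hVf f
      -- Variation of constants at the right endpoint; this is why `Ψ` is the conjugate of the
      -- reflected `φ`.
      have hwD : w D = inner ℂ Ψ f := by
        rw [eq_fundSol_add_integral (p := p) (q := q) hw hw' h0 hmemD, h0', hΨf]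
        simp [heq]
      set c := ((ν : ℂ) * fundSol p q D)⁻¹ * inner ℂ Ψ f with hc
      have hφp : IsPrimitiveOn D (fundSol p q) (fundSolDeriv p q) :=
        IsPrimitiveOn.of_hasDerivAt (hasDerivAt_fundSol p q) (continuous_fundSolDeriv p q) D
      have hψc : Continuous fun x => (p + q) * fundSolDeriv p q x - p * q * fundSol p q x := by
        have := continuous_fundSolDeriv p q; have := continuous_fundSol p q; fun_prop
      have hφp' : IsPrimitiveOn D (fundSolDeriv p q)
          (fun x => (p + q) * fundSolDeriv p q x - p * q * fundSol p q x) :=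
        IsPrimitiveOn.of_hasDerivAt (hasDerivAt_fundSolDeriv p q) hψc D
      rw [operator_graph]
      have hae : R f =ᵐ[(volume : Measure ℝ).restrict (Icc 0 D)]
          c • fundSol p q + (-(ν : ℂ)⁻¹) • w := by
        rw [hRf]
        filter_upwards [Lp.coeFn_sub (c • Φ) ((ν : ℂ)⁻¹ • V f), Lp.coeFn_smul c Φ,
          Lp.coeFn_smul (ν : ℂ)⁻¹ (V f), hΦm.coeFn_toLp, hVw] with x a1 a2 a3 a4 a5
        rw [a1, Pi.sub_apply, a2, a3, Pi.smul_apply, Pi.smul_apply, a4, a5]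
        simp [sub_eq_add_neg]
      refine ⟨_, _, _, ⟨(hφp.smul c).add (hw.smul (-(ν : ℂ)⁻¹)),
        (hφp'.smul c).add (hw'.smul (-(ν : ℂ)⁻¹)),
        ((memLp_of_continuousOn hψc.continuousOn).const_smul c).add (hm.const_smul _), ?_, ?_⟩,
        hae, ?_⟩
      · simp [h0]
      · simp only [Pi.add_apply, Pi.smul_apply, smul_eq_mul, hwD, hc]
        field_simp
        ring
      · filter_upwards [Lp.coeFn_sub (z • R f) f, Lp.coeFn_smul z (R f), hae] with x a1 a2 a3
        rw [a1, Pi.sub_apply, a2, Pi.smul_apply, a3, ← heq x]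
        simp only [Pi.add_apply, Pi.smul_apply, smul_eq_mul]
        have e1 : z = -(ν * (p * q)) - r := by rw [hmul]; ring
        have e2 : (r : ℂ) = ν - ν * (p + q) := by rw [hadd]; ring
        rw [e1, e2]
        field_simp
        ring
    -- Left inverse: variation of constants for a domain function `a` gives `V f = -ν (a - a' 0 •
    -- φ)`, and `a D = 0` gives `⟨Ψ, f⟩ = ν a' 0 φ(D)`. The two multiples of `φ` in `R f` cancel,
    -- leaving `a`.
    · intro u v huv
      rw [operator_graph] at huv
      obtain ⟨a, a', a'', ha, hua, hva⟩ := huv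
      simp only at hua hva
      set f := z • u - v with hf
      have hfa : f =ᵐ[(volume : Measure ℝ).restrict (Icc 0 D)]
          fun x => -(ν : ℂ) * (a'' x - (p + q) * a' x + p * q * a x) := by
        filter_upwards [Lp.coeFn_sub (z • u) v, Lp.coeFn_smul z u, hua, hva] with x a1 a2 a3 a4
        rw [a1, Pi.sub_apply, a2, Pi.smul_apply, a3, a4, smul_eq_mul]
        linear_combination a x * hmul - a' x * hadd
      have hint : ∀ x ∈ Icc (0 : ℝ) D, ∫ y in (0 : ℝ)..x, fundSol p q (x - y) * f y =
          -(ν : ℂ) * (a x - a' 0 * fundSol p q x) := by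
        intro x hx
        rw [eq_fundSol_add_integral (p := p) (q := q) ha.prim ha.prim' ha.left hx,
          add_sub_cancel_left, ← intervalIntegral.integral_const_mul]
        apply intervalIntegral.integral_congr_ae_restrict
        rw [uIoc_of_le hx.1]
        filter_upwards [ae_restrict_of_ae_restrict_of_subset
          (Ioc_subset_Icc_self.trans (Icc_subset_Icc_right hx.2)) hfa] with y hy
        rw [hy]
        ring
      obtain ⟨w, w', w'', hw, hw', hm, h0, h0', hVw, heq⟩ := hVf f
      have hww : ∀ x ∈ Icc (0 : ℝ) D, w x = -(ν : ℂ) * (a x - a' 0 * fundSol p q x) := by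
        intro x hx
        rw [← hint x hx, eq_fundSol_add_integral (p := p) (q := q) hw hw' h0 hx, h0']
        simp [heq]
      have hin : inner ℂ Ψ f = (ν : ℂ) * (a' 0 * fundSol p q D) := by
        rw [hΨf, hint D hmemD, ha.right]
        ring
      rw [hRf, hin]
      apply Lp.ext
      set c := ((ν : ℂ) * fundSol p q D)⁻¹ * ((ν : ℂ) * (a' 0 * fundSol p q D)) with hc
      have hc' : c = a' 0 := by rw [hc]; field_simp
      filter_upwards [Lp.coeFn_sub (c • Φ) ((ν : ℂ)⁻¹ • V f), Lp.coeFn_smul c Φ,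
          Lp.coeFn_smul (ν : ℂ)⁻¹ (V f), hΦm.coeFn_toLp, hVw, hua,
          ae_Icc_of_forall hww] with x a1 a2 a3 a4 a5 a6 a7
      rw [a1, Pi.sub_apply, a2, a3, Pi.smul_apply, Pi.smul_apply, a4, a5, a6, a7, hc']
      simp only [smul_eq_mul]
      field_simp
      ring
  · rw [← hKn]
    refine (abs_norm_sub_norm_le R K).trans ?_
    have : R - K = -((ν : ℂ)⁻¹ • V) := by rw [hR]; abel
    rw [this, norm_neg, norm_smul, norm_inv, Complex.norm_real, Real.norm_of_nonneg hν.le]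
    exact mul_le_mul_of_nonneg_left hV (inv_nonneg.2 hν.le)

/-! ### Eigenvalues at the zeros of `φ(D)` -/

/-- `fundSol p q` does not vanish identically. -/
lemma fundSol_ne_zero_on {D : ℝ} (hD : 0 < D) (p q : ℂ) :
    ¬ ∀ x ∈ Icc (0 : ℝ) D, fundSol p q x = 0 := by
  intro h
  have hφp : IsPrimitiveOn D (fundSol p q) (fundSolDeriv p q) :=
    IsPrimitiveOn.of_hasDerivAt (hasDerivAt_fundSol p q) (continuous_fundSolDeriv p q) D
  have h1 : ∀ x ∈ Icc (0 : ℝ) D, fundSolDeriv p q x = 0 :=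
    Measure.eqOn_Icc_of_ae_eq volume hD.ne (hφp.ae_eq_zero h)
      (continuous_fundSolDeriv p q).continuousOn continuousOn_const
  simpa using h1 0 ⟨le_rfl, hD.le⟩

/-- If `fundSol p q` vanishes at `D` then it is an eigenfunction. -/
lemma not_isResolventAt {ν r D : ℝ} {z p q : ℂ} (hD : 0 < D)
    (hadd : (ν : ℂ) * (p + q) = ν - r) (hmul : (ν : ℂ) * (p * q) = -(r + z))
    (hφ : fundSol p q D = 0) (R : L2 D →L[ℂ] L2 D) : ¬ IsResolventAt (operator ν r D) z R := by
  intro hR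
  have hφp : IsPrimitiveOn D (fundSol p q) (fundSolDeriv p q) :=
    IsPrimitiveOn.of_hasDerivAt (hasDerivAt_fundSol p q) (continuous_fundSolDeriv p q) D
  have hψc : Continuous fun x => (p + q) * fundSolDeriv p q x - p * q * fundSol p q x := by
    have := continuous_fundSolDeriv p q; have := continuous_fundSol p q; fun_prop
  have hφp' : IsPrimitiveOn D (fundSolDeriv p q)
      (fun x => (p + q) * fundSolDeriv p q x - p * q * fundSol p q x) :=
    IsPrimitiveOn.of_hasDerivAt (hasDerivAt_fundSolDeriv p q) hψc D
  have hΦm : MemLp (fundSol p q) 2 ((volume : Measure ℝ).restrict (Icc 0 D)) :=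
    memLp_of_continuousOn (continuous_fundSol p q).continuousOn
  set Φ : L2 D := hΦm.toLp with hΦ
  have hg : (Φ, z • Φ) ∈ (operator ν r D).graph := by
    rw [operator_graph]
    refine ⟨_, _, _, ⟨hφp, hφp', memLp_of_continuousOn hψc.continuousOn, by simp, hφ⟩,
      hΦm.coeFn_toLp, ?_⟩
    filter_upwards [Lp.coeFn_smul z Φ, hΦm.coeFn_toLp] with x a1 a2
    rw [a1, Pi.smul_apply, a2, smul_eq_mul]
    linear_combination fundSol p q x * hmul - fundSolDeriv p q x * hadd
  obtain ⟨y, hy1, hy2⟩ := (LinearPMap.mem_graph_iff _).1 hg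
  have h0 := hR.2 y
  simp only at hy1 hy2
  -- A left inverse sends `z Φ - 𝓛 Φ = 0` back to `Φ`, so `Φ` would be zero.
  rw [hy2, hy1, sub_self, map_zero] at h0
  refine fundSol_ne_zero_on hD p q (Measure.eqOn_Icc_of_ae_eq volume hD.ne
    (hΦm.coeFn_toLp.symm.trans ?_) (continuous_fundSol p q).continuousOn continuousOn_const)
  rw [← hΦ, ← h0]
  exact Lp.coeFn_zero _ _ _

/-! ### Decay of `φ(log S)` and growth of the rank one part -/

/-- The representation `φ(x) = ∫₀ˣ e^{p (x - y)} e^{q y} dy` covers equal and distinct roots alike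
and avoids dividing by `p - q`. -/
lemma norm_fundSol_le (p q : ℂ) {x : ℝ} (hx : 0 ≤ x) :
    ‖fundSol p q x‖ ≤ x * Real.exp (max p.re q.re * x) := by
  have hd : ∀ y : ℝ, HasDerivAt (fun y : ℝ => Complex.exp (-p * y) * fundSol p q y)
      (Complex.exp (-p * y) * Complex.exp (q * y)) y := by
    intro y
    convert! (hasDerivAt_cexp_mul (-p) y).mul (hasDerivAt_fundSol p q y) using 1
    rw [fundSolDeriv]
    ring
  have hc : Continuous fun y : ℝ => Complex.exp (-p * y) * Complex.exp (q * y) := by fun_prop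
  have h := intervalIntegral.integral_eq_sub_of_hasDerivAt (a := 0) (b := x)
    (fun y _ => hd y) (hc.intervalIntegrable _ _)
  have h2 : fundSol p q x =
      ∫ y in (0 : ℝ)..x, Complex.exp (p * x) * (Complex.exp (-p * y) * Complex.exp (q * y)) := by
    rw [intervalIntegral.integral_const_mul, h, fundSol_zero, mul_zero, sub_zero, ← mul_assoc,
      ← Complex.exp_add]
    simp
  rw [h2]
  refine (intervalIntegral.norm_integral_le_of_norm_le_const (C := Real.exp (max p.re q.re * x))
    fun y hy => ?_).trans ?_
  · rw [uIoc_of_le hx] at hy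
    rw [norm_mul, norm_mul, Complex.norm_exp, Complex.norm_exp, Complex.norm_exp, ← Real.exp_add,
      ← Real.exp_add]
    apply Real.exp_le_exp.2
    simp only [Complex.re_mul_ofReal, Complex.neg_re]
    have h1 := mul_le_mul_of_nonneg_right (le_max_left p.re q.re) (sub_nonneg.2 hy.2)
    have h2 := mul_le_mul_of_nonneg_right (le_max_right p.re q.re) hy.1.le
    linarith
  · rw [sub_zero, abs_of_nonneg hx, mul_comm]

lemma integral_norm_sq_fundSol_pos (p q : ℂ) {D : ℝ} (hD : 0 < D) :
    0 < ∫ x in (0 : ℝ)..D, ‖fundSol p q x‖ ^ 2 := by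
  have hc := continuous_fundSol p q
  obtain ⟨x, hx, h0⟩ : ∃ x ∈ Icc (0 : ℝ) D, fundSol p q x ≠ 0 := by
    by_contra! h
    exact fundSol_ne_zero_on hD p q h
  exact intervalIntegral.integral_pos hD (by fun_prop) (fun y _ => by positivity)
    ⟨x, hx, by positivity⟩

lemma integral_norm_sq_fundSol_mono (p q : ℂ) {c D : ℝ} (hc : 0 ≤ c) (hcD : c ≤ D) :
    ∫ x in (0 : ℝ)..c, ‖fundSol p q x‖ ^ 2 ≤ ∫ x in (0 : ℝ)..D, ‖fundSol p q x‖ ^ 2 := by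
  have hcont : Continuous fun x => ‖fundSol p q x‖ ^ 2 := by
    have := continuous_fundSol p q
    fun_prop
  exact intervalIntegral.integral_mono_interval le_rfl hc hcD
    (Eventually.of_forall fun x => by positivity) (hcont.intervalIntegrable _ _)

lemma tendsto_log_mul_rpow {b : ℝ} (hb : b < 0) :
    Tendsto (fun S : ℝ => Real.log S * S ^ b) atTop (𝓝 0) := by
  have h := (tendsto_rpow_mul_exp_neg_mul_atTop_nhds_zero 1 (-b) (by linarith)).comp
    Real.tendsto_log_atTop
  refine h.congr' ?_
  filter_upwards [eventually_gt_atTop 0] with S hS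
  rw [Function.comp_apply, Real.rpow_one, neg_neg, Real.rpow_def_of_pos hS, mul_comm b]

/-- The norm of the rank one part of the resolvent grows faster than `S ^ κ` for every `κ < -μ`. -/
lemma eventually_rpow_add_le {ν : ℝ} (hν : 0 < ν) {p q : ℂ} (hm : max p.re q.re < 0) {κ : ℝ}
    (hκ : κ < -max p.re q.re) (C : ℝ) :
    ∀ᶠ S : ℝ in atTop, fundSol p q (Real.log S) ≠ 0 →
      S ^ κ + C ≤ (∫ x in (0 : ℝ)..Real.log S, ‖fundSol p q x‖ ^ 2) /
        (ν * ‖fundSol p q (Real.log S)‖) := by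
  set m := max p.re q.re with hmdef
  -- The mass of `φ` on `[0, 1]` is a fixed positive lower bound for `‖φ‖²` once `log S ≥ 1`, so
  -- only the decay of the denominator matters.
  have hc := integral_norm_sq_fundSol_pos p q one_pos
  set c := ∫ x in (0 : ℝ)..1, ‖fundSol p q x‖ ^ 2 with hcdef
  have h1 := (tendsto_log_mul_rpow (b := κ + m) (by linarith)).const_mul ν
  have h2 := (tendsto_log_mul_rpow hm).const_mul (ν * |C|)
  have h3 := h1.add h2
  rw [mul_zero, mul_zero, add_zero] at h3
  filter_upwards [h3.eventually_lt_const hc, eventually_ge_atTop (Real.exp 1)] with S hS hSe hφ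
  have hS0 : 0 < S := (Real.exp_pos 1).trans_le hSe
  have hlog : 1 ≤ Real.log S := (Real.le_log_iff_exp_le hS0).2 hSe
  have hpos : 0 < ‖fundSol p q (Real.log S)‖ := norm_pos_iff.2 hφ
  rw [le_div_iff₀ (by positivity)]
  refine le_trans ?_ (integral_norm_sq_fundSol_mono p q zero_le_one hlog)
  rw [← hcdef]
  refine le_trans ?_ hS.le
  have hle := norm_fundSol_le p q (x := Real.log S) (by linarith)
  rw [mul_comm (max _ _), ← Real.rpow_def_of_pos hS0, ← hmdef] at hle
  have hk := Real.rpow_pos_of_pos hS0 κ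
  calc (S ^ κ + C) * (ν * ‖fundSol p q (Real.log S)‖)
      ≤ (S ^ κ + |C|) * (ν * ‖fundSol p q (Real.log S)‖) := by
        gcongr
        exact le_abs_self C
    _ ≤ (S ^ κ + |C|) * (ν * (Real.log S * S ^ m)) := by gcongr
    _ = ν * (Real.log S * S ^ (κ + m)) + ν * |C| * (Real.log S * S ^ m) := by
        rw [Real.rpow_add hS0]; ring

/-- The dominant exponential factors out: `φ(x) = (1 - e^{(q - p) x}) e^{p x} / (p - q)`, and the
first factor tends to `1`. -/
lemma isEquivalent_norm_fundSol {p q : ℂ} (hpq : q.re < p.re) :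
    (fun S : ℝ => ‖fundSol p q (Real.log S)‖) ~[atTop]
      (fun S : ℝ => S ^ max p.re q.re / ‖p - q‖) := by
  have hne : p ≠ q := fun h => by simp [h] at hpq
  have ht : Tendsto (fun S : ℝ => ‖1 - Complex.exp ((q - p) * (Real.log S : ℝ))‖) atTop
      (𝓝 1) := by
    have h0 : Tendsto (fun S : ℝ => Complex.exp ((q - p) * (Real.log S : ℝ))) atTop (𝓝 0) := by
      rw [Complex.tendsto_exp_nhds_zero_iff]
      have : ∀ S : ℝ, ((q - p) * (Real.log S : ℝ)).re = (q.re - p.re) * Real.log S := by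
        intro S; rw [Complex.re_mul_ofReal, Complex.sub_re]
      simp only [this]
      exact Real.tendsto_log_atTop.const_mul_atTop_of_neg (by linarith)
    simpa using (h0.const_sub 1).norm
  refine isEquivalent_iff_exists_eq_mul.2 ⟨_, ht, ?_⟩
  filter_upwards [eventually_gt_atTop 0] with S hS
  have e : fundSol p q (Real.log S) =
      (1 - Complex.exp ((q - p) * (Real.log S : ℝ))) *
        (Complex.exp (p * (Real.log S : ℝ)) / (p - q)) := by
    have e0 : Complex.exp (q * (Real.log S : ℝ)) =
        Complex.exp ((q - p) * (Real.log S : ℝ)) * Complex.exp (p * (Real.log S : ℝ)) := by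
      rw [← Complex.exp_add]
      ring_nf
    rw [fundSol, if_neg hne, e0]
    ring
  rw [e, norm_mul, norm_div, Complex.norm_exp (p * _), Pi.mul_apply, max_eq_left hpq.le,
    Complex.re_mul_ofReal, Real.rpow_def_of_pos hS, mul_comm p.re]

/-! ### Location of the roots -/

/-- The points of the interior of `Π` only have symbol preimages in the open left half plane. -/
lemma re_neg_of_symbol_mem_interior {ν r : ℝ} (hν : 0 < ν) {α : ℂ}
    (h : symbol ν r α ∈ interior (regionPi ν r)) : α.re < 0 := by
  -- The symbol at `α + t`, for small real `t > 0`, still lies in `Π`, so it has a preimage `b` in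
  -- the strip. Either `b = α + t` or `b` is the other root `-(r - ν)/ν - (α + t)`. The root swap
  -- preserves the strip, so in both cases `Re α + t ≤ 0`.
  have hcont : Continuous fun t : ℝ => symbol ν r (α + t) := by
    unfold symbol
    fun_prop
  have hmem : ∀ᶠ t : ℝ in 𝓝 0, symbol ν r (α + t) ∈ regionPi ν r := by
    apply hcont.continuousAt.eventually
    simpa using mem_interior_iff_mem_nhds.1 h
  have hmem' : ∀ᶠ t : ℝ in 𝓝[>] 0, symbol ν r (α + t) ∈ regionPi ν r :=
    hmem.filter_mono nhdsWithin_le_nhds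
  obtain ⟨t, ⟨b, ⟨hb1, hb2⟩, hb⟩, ht⟩ := (hmem'.and self_mem_nhdsWithin).exists
  have ht0 : 0 < t := ht
  have hν' : (ν : ℂ) ≠ 0 := by exact_mod_cast hν.ne'
  have hprod : (b - (α + t)) * (ν * (b + (α + t)) + (r - ν)) = 0 := by
    simp only [symbol] at hb
    linear_combination hb
  rcases mul_eq_zero.1 hprod with h0 | h0
  · have := congrArg Complex.re h0
    simp only [Complex.sub_re, Complex.add_re, Complex.ofReal_re, Complex.zero_re] at this
    linarith
  · have := congrArg Complex.re h0
    simp only [Complex.sub_re, Complex.add_re, Complex.ofReal_re, Complex.zero_re,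
      Complex.re_ofReal_mul] at this
    have h3 : (r - ν) / ν * ν = r - ν := by field_simp
    nlinarith

lemma sqrt_disc_sq (w : ℂ) : (w ^ (1 / 2 : ℂ)) ^ 2 = w := by
  rw [one_div]
  exact Complex.cpow_ofNat_inv_pow w 2

lemma alpha_add {ν : ℝ} (hν : 0 < ν) (r : ℝ) (z : ℂ) :
    (ν : ℂ) * (alphaPlus ν r z + alphaMinus ν r z) = ν - r := by
  have hν' : (ν : ℂ) ≠ 0 := by exact_mod_cast hν.ne'
  rw [alphaPlus, alphaMinus]
  field_simp
  ring

lemma alpha_mul {ν : ℝ} (hν : 0 < ν) (r : ℝ) (z : ℂ) :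
    (ν : ℂ) * (alphaPlus ν r z * alphaMinus ν r z) = -(r + z) := by
  have hν' : (ν : ℂ) ≠ 0 := by exact_mod_cast hν.ne'
  have h := sqrt_disc_sq (((r : ℂ) + ν) ^ 2 + 4 * z * ν)
  rw [alphaPlus, alphaMinus]
  set s := (((r : ℂ) + ν) ^ 2 + 4 * z * ν) ^ (1 / 2 : ℂ)
  field_simp
  linear_combination -h

lemma symbol_alphaPlus {ν : ℝ} (hν : 0 < ν) (r : ℝ) (z : ℂ) :
    symbol ν r (alphaPlus ν r z) = z := by
  rw [symbol]
  linear_combination alphaPlus ν r z * alpha_add hν r z - alpha_mul hν r z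

lemma symbol_alphaMinus {ν : ℝ} (hν : 0 < ν) (r : ℝ) (z : ℂ) :
    symbol ν r (alphaMinus ν r z) = z := by
  rw [symbol]
  linear_combination alphaMinus ν r z * alpha_add hν r z - alpha_mul hν r z

lemma phi_eq_fundSol (ν r : ℝ) (z : ℂ) :
    phi ν r z = fundSol (alphaPlus ν r z) (alphaMinus ν r z) := by
  funext x
  simp [phi, fundSol]

/-- Off the half-line of real discriminant at most zero, the two roots have different real parts. -/
lemma alphaMinus_re_lt {ν r : ℝ} (hν : 0 < ν) {z : ℂ}
    (hz : z ∉ (fun t : ℝ => (t : ℂ)) '' Iic (-(((r + ν) / 2) ^ 2 * (1 / ν)))) :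
    (alphaMinus ν r z).re < (alphaPlus ν r z).re := by
  have hν' : (ν : ℂ) ≠ 0 := by exact_mod_cast hν.ne'
  set w := ((r : ℂ) + ν) ^ 2 + 4 * z * ν with hw
  have hs : 0 < (w ^ (1 / 2 : ℂ)).re := by
    rw [one_div, Complex.cpow_inv_two_re]
    -- The principal root has real part `√((‖w‖ + Re w) / 2)`. If this vanishes then `w` is real and
    -- nonpositive, which puts `z` on the excluded half-line.
    apply Real.sqrt_pos.2
    by_contra hneg
    have hle : ‖w‖ ≤ -w.re := by linarith
    have h1 := Complex.abs_re_le_norm w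
    have hre : w.re ≤ 0 := by linarith [norm_nonneg w]
    have him : w.im = 0 := by
      have h2 := Complex.sq_norm w
      rw [Complex.normSq_apply] at h2
      have h3 : ‖w‖ ^ 2 ≤ w.re ^ 2 := by nlinarith [norm_nonneg w]
      nlinarith
    refine hz ⟨(w.re - (r + ν) ^ 2) / (4 * ν), ?_, ?_⟩
    · have e : -(((r + ν) / 2) ^ 2 * (1 / ν)) = (0 - (r + ν) ^ 2) / (4 * ν) := by
        field_simp; ring
      rw [mem_Iic, e]
      gcongr
    · have hwr : (w.re : ℂ) = w := Complex.ext (by simp) (by simp [him])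
      simp only
      push_cast
      rw [hwr, hw]
      field_simp
      ring
  have e : alphaPlus ν r z - alphaMinus ν r z = ((ν⁻¹ : ℝ) : ℂ) * w ^ (1 / 2 : ℂ) := by
    rw [alphaPlus, alphaMinus, ← hw]
    push_cast
    field_simp
    ring
  have h := congrArg Complex.re e
  rw [Complex.sub_re, Complex.re_ofReal_mul] at h
  have := mul_pos (inv_pos.2 hν) hs
  linarith

/-! ### Asymptotics of the resolvent norm -/

/-- The resolvent norm is asymptotic to the norm of its rank one part. -/
lemma isEquivalent_resolventNorm {ν r : ℝ} {z p q : ℂ} (hν : 0 < ν) (hp : p.re < 0)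
    (hq : q.re < 0) (hadd : (ν : ℂ) * (p + q) = ν - r) (hmul : (ν : ℂ) * (p * q) = -(r + z)) :
    (fun S : ℝ => (resolventNorm (operator ν r (Real.log S)) z).toReal)
      ~[atTop ⊓ 𝓟 {S : ℝ | fundSol p q (Real.log S) ≠ 0}]
      (fun S : ℝ => (∫ x in (0 : ℝ)..Real.log S, ‖fundSol p q x‖ ^ 2) /
        (ν * ‖fundSol p q (Real.log S)‖)) := by
  have hm : max p.re q.re < 0 := max_lt hp hq
  set M : ℝ → ℝ := fun S => (∫ x in (0 : ℝ)..Real.log S, ‖fundSol p q x‖ ^ 2) /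
        (ν * ‖fundSol p q (Real.log S)‖) with hM
  have hMt : Tendsto M (atTop ⊓ 𝓟 {S : ℝ | fundSol p q (Real.log S) ≠ 0}) atTop := by
    refine tendsto_atTop.2 fun C => eventually_inf_principal.2 ?_
    filter_upwards [eventually_rpow_add_le hν hm (κ := 0) (by linarith) C] with S hS hφ
    have := hS hφ
    rw [Real.rpow_zero] at this
    simp only [hM]
    linarith
  -- The two sides differ by a bounded amount, which is negligible because `M` tends to infinity.
  refine IsLittleO.isEquivalent (IsBigO.trans_isLittleO (g := fun _ : ℝ => (1 : ℝ)) ?_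
    ((isLittleO_const_left.2 (Or.inr (tendsto_norm_atTop_atTop.comp hMt)))))
  refine IsBigO.of_bound (ν⁻¹ * ((-p.re)⁻¹ * (-q.re)⁻¹)) (eventually_inf_principal.2 ?_)
  filter_upwards [eventually_ge_atTop 1] with S hS hφ
  obtain ⟨R, hR, hb⟩ := exists_isResolventAt hν (Real.log_nonneg hS) hp hq hadd hmul hφ
  rw [Pi.sub_apply, hR.resolventNorm_eq, toReal_enorm, norm_one, mul_one]
  exact hb

lemma resolventNorm_eq_top_iff_fundSol {ν r D : ℝ} {z p q : ℂ} (hν : 0 < ν) (hD : 0 < D)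
    (hp : p.re < 0) (hq : q.re < 0) (hadd : (ν : ℂ) * (p + q) = ν - r)
    (hmul : (ν : ℂ) * (p * q) = -(r + z)) :
    resolventNorm (operator ν r D) z = ∞ ↔ fundSol p q D = 0 := by
  rw [resolventNorm_eq_top_iff]
  refine ⟨fun h => ?_, fun h => ?_⟩
  · by_contra hφ
    obtain ⟨R, hR, -⟩ := exists_isResolventAt hν hD.le hp hq hadd hmul hφ
    exact h ⟨R, hR⟩
  · rintro ⟨R, hR⟩
    exact not_isResolventAt hD hadd hmul h R hR

/-- At zeros of `φ(log S)` the norm is infinite. Elsewhere the uniform error is absorbed by taking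
it as the constant `C` in `eventually_rpow_add_le`. -/
lemma eventually_rpow_le_resolventNorm {ν r : ℝ} {z p q : ℂ} (hν : 0 < ν) (hp : p.re < 0)
    (hq : q.re < 0) (hadd : (ν : ℂ) * (p + q) = ν - r) (hmul : (ν : ℂ) * (p * q) = -(r + z))
    {κ : ℝ} (hκ : κ < -max p.re q.re) :
    ∀ᶠ S : ℝ in atTop,
      ENNReal.ofReal (S ^ κ) ≤ resolventNorm (operator ν r (Real.log S)) z := by
  filter_upwards [eventually_rpow_add_le hν (max_lt hp hq) hκ
    (ν⁻¹ * ((-p.re)⁻¹ * (-q.re)⁻¹)), eventually_gt_atTop 1] with S hS hS1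
  have hD := Real.log_pos hS1
  by_cases hφ : fundSol p q (Real.log S) = 0
  · rw [(resolventNorm_eq_top_iff_fundSol hν hD hp hq hadd hmul).2 hφ]
    exact le_top
  · obtain ⟨R, hR, hb⟩ := exists_isResolventAt hν hD.le hp hq hadd hmul hφ
    rw [hR.resolventNorm_eq, ← ofReal_norm]
    apply ENNReal.ofReal_le_ofReal
    have h1 := hS hφ
    have h2 := (abs_le.1 hb).1
    linarith

end BlackScholes

/-! ### The main theorem -/

theorem theorem4p1 (ν r : ℝ) (hν : 0 < ν) (z : ℂ)
    (hz : z ∈ interior (BlackScholes.regionPi ν r)) (β τ : ℝ)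
    (hβτ : BlackScholes.alphaPlus ν r z - BlackScholes.alphaMinus ν r z = β + τ * Complex.I) :
    -- both exponentials decay
    BlackScholes.decayRate ν r z < 0 ∧
    -- the two sides of the first asymptotic relation are infinite for the same values of `S`
    (∀ S : ℝ, 1 < S →
      (BlackScholes.resolventNorm (BlackScholes.operator ν r (Real.log S)) z = ∞ ↔
        BlackScholes.phi ν r z (Real.log S) = 0)) ∧
    -- asymptotics of the resolvent norm, along all `S` for which it is finite
    (fun S : ℝ => (BlackScholes.resolventNorm
        (BlackScholes.operator ν r (Real.log S)) z).toReal)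
      ~[atTop ⊓ 𝓟 {S : ℝ | BlackScholes.phi ν r z (Real.log S) ≠ 0}]
      (fun S : ℝ => BlackScholes.phiNormSq ν r z (Real.log S) /
        (ν * ‖BlackScholes.phi ν r z (Real.log S)‖)) ∧
    -- away from the half-line the resolvent norm is finite for large `S`, with explicit growth
    (z ∉ (fun t : ℝ => (t : ℂ)) '' Iic (-(((r + ν) / 2) ^ 2 * (1 / ν))) →
      (∀ᶠ S : ℝ in atTop,
        BlackScholes.resolventNorm (BlackScholes.operator ν r (Real.log S)) z ≠ ∞) ∧
      (fun S : ℝ => ‖BlackScholes.phi ν r z (Real.log S)‖) ~[atTop]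
        (fun S : ℝ => S ^ BlackScholes.decayRate ν r z /
          ‖BlackScholes.alphaPlus ν r z - BlackScholes.alphaMinus ν r z‖) ∧
      (fun S : ℝ => (BlackScholes.resolventNorm
          (BlackScholes.operator ν r (Real.log S)) z).toReal) ~[atTop]
        (fun S : ℝ => S ^ (-BlackScholes.decayRate ν r z) * Real.sqrt (β ^ 2 + τ ^ 2) *
          BlackScholes.phiNormSq ν r z (Real.log S) / ν)) ∧
    -- growth of the resolvent norm at every interior point
    (∀ κ : ℝ, κ < -BlackScholes.decayRate ν r z →
      ∀ᶠ S : ℝ in atTop, ENNReal.ofReal (S ^ κ) ≤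
        BlackScholes.resolventNorm (BlackScholes.operator ν r (Real.log S)) z) := by
  have hp : (BlackScholes.alphaPlus ν r z).re < 0 :=
    BlackScholes.re_neg_of_symbol_mem_interior hν
      (by rwa [BlackScholes.symbol_alphaPlus hν])
  have hq : (BlackScholes.alphaMinus ν r z).re < 0 :=
    BlackScholes.re_neg_of_symbol_mem_interior hν
      (by rwa [BlackScholes.symbol_alphaMinus hν])
  have hadd := BlackScholes.alpha_add hν r z
  have hmul := BlackScholes.alpha_mul hν r z
  have htop : ∀ S : ℝ, 1 < S →
      (BlackScholes.resolventNorm (BlackScholes.operator ν r (Real.log S)) z = ∞ ↔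
        BlackScholes.phi ν r z (Real.log S) = 0) := fun S hS => by
    rw [BlackScholes.phi_eq_fundSol]
    exact BlackScholes.resolventNorm_eq_top_iff_fundSol hν (Real.log_pos hS) hp hq hadd hmul
  have hasymp := BlackScholes.isEquivalent_resolventNorm hν hp hq hadd hmul
  refine ⟨max_lt hp hq, htop, ?_, fun hzline => ?_, fun κ hκ =>
    BlackScholes.eventually_rpow_le_resolventNorm hν hp hq hadd hmul hκ⟩
  · simp only [BlackScholes.phiNormSq, BlackScholes.phi_eq_fundSol]
    exact hasymp
  · have hlt := BlackScholes.alphaMinus_re_lt hν hzline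
    have hφ := BlackScholes.isEquivalent_norm_fundSol hlt
    set p := BlackScholes.alphaPlus ν r z with hpdef
    set q := BlackScholes.alphaMinus ν r z with hqdef
    have hnorm : 0 < ‖p - q‖ := by
      refine norm_pos_iff.2 (sub_ne_zero.2 fun h => ?_)
      rw [h] at hlt
      exact lt_irrefl _ hlt
    have hne : ∀ᶠ S : ℝ in atTop, BlackScholes.fundSol p q (Real.log S) ≠ 0 := by
      have hpos : ∀ᶠ S : ℝ in atTop, 0 < S ^ max p.re q.re / ‖p - q‖ := by
        filter_upwards [eventually_gt_atTop 0] with S hS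
        have := Real.rpow_pos_of_pos hS (max p.re q.re)
        positivity
      filter_upwards [hφ.eventually_pos hpos] with S hS
      exact norm_pos_iff.1 hS
    simp only [BlackScholes.phiNormSq, BlackScholes.phi_eq_fundSol] at htop ⊢
    refine ⟨?_, hφ, ?_⟩
    · filter_upwards [hne, eventually_gt_atTop 1] with S hS hS1
      rw [Ne, htop S hS1]
      exact hS
    -- Off the half-line `φ(log S)` is eventually nonzero, so restricting to its nonzero set does
    -- not change the filter.
    · have hfilter : atTop ⊓ 𝓟 {S : ℝ | BlackScholes.fundSol p q (Real.log S) ≠ 0} = atTop :=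
        inf_eq_left.2 (le_principal_iff.2 hne)
      rw [hfilter] at hasymp
      refine hasymp.trans ?_
      have h1 := (IsEquivalent.refl (l := atTop) (u := fun S : ℝ =>
        ∫ x in (0 : ℝ)..Real.log S, ‖BlackScholes.fundSol p q x‖ ^ 2)).div
        ((IsEquivalent.refl (l := atTop) (u := fun _ : ℝ => ν)).mul hφ)
      refine h1.trans_eventuallyEq ?_
      filter_upwards [eventually_gt_atTop 0] with S hS
      have hsqrt : Real.sqrt (β ^ 2 + τ ^ 2) = ‖p - q‖ := by
        rw [hβτ, Complex.norm_add_mul_I]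
      have hpow := Real.rpow_pos_of_pos hS (max p.re q.re)
      simp only [Pi.div_apply, Pi.mul_apply]
      rw [hsqrt, BlackScholes.decayRate, ← hpdef, ← hqdef, Real.rpow_neg hS.le]
      field_simp
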